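/- Consider quantum circuits on $n$ qubits built from one-qubit gates (elements of $U(2)$ acting on one qubit) and {\tt CNOT} gates (on any two distinct qubits, in either orientation). Let $(\mathbf{C}^2)^{\otimes n} = E_0 \oplus E_1$ be any decomposition into two orthogonal subspaces, one of which is one-dimensional. A circuit \emph{simulates} an operator $u \in U(2^n)$ \emph{up to the projective measurement onto} $E_0, E_1$ if the operator it computes equals $e^{i\theta} v u$ for some $\theta \in \mathbf{R}$ and some $v \in U(2^n)$ that preserves both $E_0$ and $E_1$. A generic circuit is a circuit diagram of {\tt CNOT}s and placeholders, each placeholder standing on a given qubit for a one-qubit gate from a given subset of $U(2)$; it is \emph{universal up to the measurement} if for every $u \in U(2^n)$ some choice of values of its placeholders gives a circuit that simulates $u$ up to the measurement. Then: (1) For every $n$ and every such decomposition there is a $u \in U(2^n)$ such that every circuit simulating $u$ up to the measurement contains at least $\lceil (2^n - 3n - 1)/4 \rceil$ {\tt CNOT} gates. (2) There is an absolute constant $C$ such that for every $n$ and every such decomposition there is a generic circuit with at most $C \cdot 2^n$ {\tt CNOT} gates that is universal up to the measurement; that is, $O(2^n)$ {\tt CNOT} gates suffice. (3) For $n = 2$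 and every such decomposition, one {\tt CNOT} is necessary and sufficient: there is a $u \in U(4)$ such that every circuit simulating $u$ up to the measurement contains at least one {\tt CNOT} gate, and there is a generic circuit with exactly one {\tt CNOT} gate that is universal up to the measurement. -/

import Mathlib

namespace QuantumCircuit

/-- The state space `(ℂ²)^{⊗ n}` of `n` qubits, with its computational basis indexed by bit
strings `Fin n → Fin 2`. -/
abbrev StateSpace (n : ℕ) : Type := EuclideanSpace ℂ (Fin n → Fin 2)

/-- The `n`-qubit operators: the group `U(2^n)`, in the computational basis. -/
abbrev Operator (n : ℕ) : Type := Matrix.unitaryGroup (Fin n → Fin 2) ℂ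

/-- The one-qubit gates: the group `U(2)`. -/
abbrev OneQubit : Type := Matrix.unitaryGroup (Fin 2) ℂ

/-- The matrix of the one-qubit operator `a` acting on qubit `q` and trivially on all others. -/
def oneQubitMatrix {n : ℕ} (q : Fin n) (a : OneQubit) :
    Matrix (Fin n → Fin 2) (Fin n → Fin 2) ℂ :=
  fun x y => if ∀ j, j ≠ q → x j = y j then (a : Matrix (Fin 2) (Fin 2) ℂ) (x q) (y q) else 0

/-- The matrix of the CNOT with control `c` and target `t`: it sends the basis vector `|y⟩` to
the basis vector in which the bit `y t` is replaced by `y t + y c` (mod 2). -/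
def cnotMatrix {n : ℕ} (c t : Fin n) : Matrix (Fin n → Fin 2) (Fin n → Fin 2) ℂ :=
  fun x y => if x = Function.update y t (y t + y c) then 1 else 0

/-- Gates on `n` qubits: a one-qubit gate on some qubit, or a CNOT on two distinct qubits. -/
inductive Gate (n : ℕ) : Type
  | oneQubit (q : Fin n) (a : OneQubit) : Gate n
  | cnot (c t : Fin n) (h : c ≠ t) : Gate n

/-- The operator of a gate. -/
def Gate.matrix {n : ℕ} : Gate n → Matrix (Fin n → Fin 2) (Fin n → Fin 2) ℂ
  | .oneQubit q a => oneQubitMatrix q a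
  | .cnot c t _ => cnotMatrix c t

/-- A circuit of CNOTs and one-qubit gates; the head of the list acts first. -/
abbrev Circuit (n : ℕ) : Type := List (Gate n)

/-- The operator computed by a circuit. -/
def circuitMatrix {n : ℕ} : Circuit n → Matrix (Fin n → Fin 2) (Fin n → Fin 2) ℂ
  | [] => 1
  | g :: c => circuitMatrix c * g.matrix

/-- The number of CNOT gates of a circuit. -/
def cnotCount {n : ℕ} : Circuit n → ℕ
  | [] => 0
  | .oneQubit _ _ :: c => cnotCount c
  | .cnot _ _ _ :: c => cnotCount c + 1

/-- The circuit simulates the operator `w` up to global phase. -/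
def SimulatesUpToPhase {n : ℕ} (c : Circuit n) (w : Operator n) : Prop :=
  ∃ θ : ℝ, circuitMatrix c =
    Complex.exp (θ * Complex.I) • (w : Matrix (Fin n → Fin 2) (Fin n → Fin 2) ℂ)

/-- The family `E` is an orthogonal decomposition `(ℂ²)^{⊗ n} = ⨁ i, E i`. -/
def IsOrthogonalDecomposition {n : ℕ} {ι : Type} (E : ι → Submodule ℂ (StateSpace n)) : Prop :=
  (∀ i j, i ≠ j → E i ⟂ E j) ∧ ⨆ i, E i = ⊤

/-- The operator `v` preserves each of the subspaces `E i`. -/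
def Preserves {n : ℕ} {ι : Type} (E : ι → Submodule ℂ (StateSpace n)) (v : Operator n) : Prop :=
  ∀ i, ∀ x ∈ E i,
    Matrix.toEuclideanLin (v : Matrix (Fin n → Fin 2) (Fin n → Fin 2) ℂ) x ∈ E i

/-- The circuit simulates `u` up to the measurement don't care of the decomposition `E`: up to
global phase it simulates some operator `v * u` with `v` preserving each `E i`. -/
def SimulatesUpToMeasurement {n : ℕ} {ι : Type} (E : ι → Submodule ℂ (StateSpace n))
    (c : Circuit n) (u : Operator n) : Prop :=
  ∃ v : Operator n, Preserves E v ∧ SimulatesUpToPhase c (v * u)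

/-- The entries of a generic circuit: a placeholder on some qubit for the one-qubit gates in a
set `S` (a constant one-qubit gate when `S` is a singleton), or a constant CNOT. -/
inductive GenericGate (n : ℕ) : Type
  | placeholder (q : Fin n) (S : Set OneQubit) : GenericGate n
  | cnot (c t : Fin n) (h : c ≠ t) : GenericGate n

/-- A generic circuit: a circuit diagram with placeholders; the head of the list acts first. -/
abbrev GenericCircuit (n : ℕ) : Type := List (GenericGate n)

/-- The gate is obtained from the entry by specifying a value for the placeholder, if any. -/
inductive GenericGate.Specializes {n : ℕ} : GenericGate n → Gate n → Prop
  | placeholder (q : Fin n) (S : Set OneQubit) (a : OneQubit) (ha : a ∈ S) :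
      Specializes (.placeholder q S) (.oneQubit q a)
  | cnot (c t : Fin n) (h : c ≠ t) : Specializes (.cnot c t h) (.cnot c t h)

/-- The number of CNOT gates of a generic circuit. -/
def genericCnotCount {n : ℕ} : GenericCircuit n → ℕ
  | [] => 0
  | .placeholder _ _ :: T => genericCnotCount T
  | .cnot _ _ _ :: T => genericCnotCount T + 1

/-- The generic circuit `T` is universal up to the measurement don't care of `E`: by specifying
values for its placeholders one can simulate every operator up to that don't care. -/
def UniversalUpToMeasurement {n : ℕ} {ι : Type} (E : ι → Submodule ℂ (StateSpace n))
    (T : GenericCircuit n) : Prop :=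
  ∀ u : Operator n, ∃ c : Circuit n,
    List.Forall₂ GenericGate.Specializes T c ∧ SimulatesUpToMeasurement E c u

/-- A projective measurement onto two orthogonal subspaces, one of which is one-dimensional. -/
def IsLineMeasurement {n : ℕ} (E : Fin 2 → Submodule ℂ (StateSpace n)) : Prop :=
  IsOrthogonalDecomposition E ∧ ∃ i, Module.finrank ℂ (E i) = 1

end QuantumCircuit

/-! Let the unit vector `ψ` span the one-dimensional subspace. The other subspace is its orthogonal
complement, so a unitary preserves the decomposition exactly when it fixes this line, and a circuit
simulates `u` iff it sends `u⁻¹ ψ` to a multiple of `ψ`. As `u` varies, `u⁻¹ ψ` runs over all unit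
vectors, so everything reduces to transporting states (`IsLineMeasurement.exists_unit_vector`).

Lower bound: run backwards from `ψ`, circuits with at most `m` CNOTs reach only states in countably
many `C¹` images of real spaces of dimension at most `2 + 4n + 8m`. If this is below `2 * 2 ^ n`,
Hausdorff dimension leaves a unit vector unreached (`exists_isUnitVector_not_reachable`).

Upper bound: a Z- and then a Y-rotation of qubit `t`, both controlled by the earlier qubits, bring
it to `0` once all later qubits are `0`, using `O(2 ^ t)` CNOTs
(`exists_genericCircuit_disentangle_qubit`). A geometric sum takes any state to a multiple of
`|0…0⟩`; the inverse of such a circuit for `ψ` then leads to `ψ`.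

Two qubits: the modulus of the determinant of the `2 × 2` amplitude matrix is a complete invariant
of unit vectors under one-qubit gates (`exists_locally_equivalent`). Circuits without CNOTs preserve
it, while one CNOT after suitable one-qubit gates produces every value in `[0, 1/2]`
(`exists_norm_det_applyCnot`). -/

namespace QuantumCircuit

open Function Matrix

variable {n : ℕ}

/-! ### Gates acting on state vectors -/

/-- The amplitudes of an `n`-qubit state vector in the computational basis. -/
abbrev Amplitudes (n : ℕ) : Type := (Fin n → Fin 2) → ℂ

/-- The action of a `2 × 2` matrix on qubit `q` of a state vector. -/
def applyQubit (q : Fin n) (a : Matrix (Fin 2) (Fin 2) ℂ) (v : Amplitudes n) : Amplitudes n :=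
  fun x => ∑ b, a (x q) b * v (update x q b)

/-- The action of a CNOT on a state vector. -/
def applyCnot (c t : Fin n) (v : Amplitudes n) : Amplitudes n :=
  fun x => v (update x t (x t + x c))

theorem oneQubitMatrix_mulVec (q : Fin n) (a : OneQubit) (v : Amplitudes n) :
    oneQubitMatrix q a *ᵥ v = applyQubit q a v := by
  funext x
  simp only [mulVec, dotProduct, applyQubit]
  symm
  refine Fintype.sum_of_injective (fun b => update x q b) (update_injective x q) _ _ ?_ ?_
  · intro y hy
    have : ¬ ∀ j, j ≠ q → x j = y j := by
      intro h
      refine hy ⟨y q, ?_⟩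
      funext j
      by_cases hj : j = q
      · subst hj; simp
      · simp [update_of_ne hj, h j hj]
    simp [oneQubitMatrix, this]
  · intro b
    have : ∀ j, j ≠ q → x j = update x q b j := fun j hj => by simp [update_of_ne hj]
    rw [oneQubitMatrix, if_pos this, update_self]

theorem fin_two_add_self (a : Fin 2) : a + a = 0 := by
  fin_cases a <;> rfl

theorem fin_two_add_add_cancel (a b : Fin 2) : a + b + b = a := by
  rw [add_assoc, fin_two_add_self, add_zero]

theorem eq_update_add_iff {c t : Fin n} (h : c ≠ t) (x y : Fin n → Fin 2) :
    x = update y t (y t + y c) ↔ y = update x t (x t + x c) := by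
  constructor <;>
  · intro e
    rw [e]
    simp [update_of_ne h, fin_two_add_add_cancel]

theorem cnotMatrix_mulVec {c t : Fin n} (h : c ≠ t) (v : Amplitudes n) :
    cnotMatrix c t *ᵥ v = applyCnot c t v := by
  funext x
  simp [mulVec, dotProduct, applyCnot, cnotMatrix, eq_update_add_iff h x]

theorem applyQubit_mul (q : Fin n) (a b : Matrix (Fin 2) (Fin 2) ℂ) (v : Amplitudes n) :
    applyQubit q a (applyQubit q b v) = applyQubit q (a * b) v := by
  funext x
  simp only [applyQubit, Matrix.mul_apply, update_self, update_idem, Fin.sum_univ_two]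
  ring

theorem applyQubit_one (q : Fin n) (v : Amplitudes n) : applyQubit q 1 v = v := by
  funext x
  simp [applyQubit, Matrix.one_apply]

theorem applyQubit_smul (q : Fin n) (a : Matrix (Fin 2) (Fin 2) ℂ) (z : ℂ) (v : Amplitudes n) :
    applyQubit q a (z • v) = z • applyQubit q a v := by
  funext x
  simp only [applyQubit, Pi.smul_apply, smul_eq_mul, Fin.sum_univ_two]
  ring

theorem smul_applyQubit (q : Fin n) (a : Matrix (Fin 2) (Fin 2) ℂ) (z : ℂ) (v : Amplitudes n) :
    applyQubit q (z • a) v = z • applyQubit q a v := by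
  funext x
  simp only [applyQubit, Pi.smul_apply, Matrix.smul_apply, smul_eq_mul, Fin.sum_univ_two]
  ring

theorem applyCnot_smul (c t : Fin n) (z : ℂ) (v : Amplitudes n) :
    applyCnot c t (z • v) = z • applyCnot c t v := rfl

theorem applyQubit_comm {q r : Fin n} (h : q ≠ r) (a b : Matrix (Fin 2) (Fin 2) ℂ)
    (v : Amplitudes n) :
    applyQubit q a (applyQubit r b v) = applyQubit r b (applyQubit q a v) := by
  funext x
  simp only [applyQubit, update_of_ne h, update_of_ne h.symm, Fin.sum_univ_two,
    update_comm h]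
  ring

theorem applyQubit_applyCnot {q c t : Fin n} (hc : q ≠ c) (ht : q ≠ t)
    (a : Matrix (Fin 2) (Fin 2) ℂ) (v : Amplitudes n) :
    applyQubit q a (applyCnot c t v) = applyCnot c t (applyQubit q a v) := by
  funext x
  simp only [applyQubit, applyCnot, update_of_ne ht, update_of_ne hc.symm, update_of_ne ht.symm,
    Fin.sum_univ_two, update_comm ht]

theorem applyCnot_applyCnot {c t : Fin n} (h : c ≠ t) (v : Amplitudes n) :
    applyCnot c t (applyCnot c t v) = v := by
  funext x
  simp only [applyCnot]
  congr 1
  simp [update_of_ne h, fin_two_add_add_cancel]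

/-! ### Inverses, concatenation and CNOT counts of circuits -/

/-- The inverse of a gate. -/
def Gate.inv : Gate n → Gate n
  | .oneQubit q a => .oneQubit q a⁻¹
  | .cnot c t h => .cnot c t h

theorem Gate.matrix_conjTranspose (g : Gate n) : g.matrixᴴ = g.inv.matrix := by
  cases g with
  | oneQubit q a =>
    ext x y
    simp only [matrix, inv, oneQubitMatrix, conjTranspose_apply, Matrix.UnitaryGroup.inv_val,
      star_eq_conjTranspose]
    by_cases h : ∀ j, j ≠ q → x j = y j
    · rw [if_pos h, if_pos fun j hj => (h j hj).symm]
    · rw [if_neg h, if_neg fun h' => h fun j hj => (h' j hj).symm, star_zero]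
  | cnot c t h =>
    ext x y
    simp only [matrix, inv, cnotMatrix, conjTranspose_apply, eq_update_add_iff h x]
    split_ifs <;> simp

theorem Gate.inv_matrix_mul (g : Gate n) : g.inv.matrix * g.matrix = 1 := by
  refine Matrix.ext_of_mulVec_single fun i => ?_
  rw [← mulVec_mulVec, one_mulVec]
  cases g with
  | oneQubit q a =>
    simp only [inv, matrix, oneQubitMatrix_mulVec, applyQubit_mul]
    rw [← UnitaryGroup.mul_val, inv_mul_cancel, UnitaryGroup.one_val, applyQubit_one]
  | cnot c t h =>
    simp only [inv, matrix, cnotMatrix_mulVec h, applyCnot_applyCnot h]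

theorem circuitMatrix_mem (c : Circuit n) :
    circuitMatrix c ∈ Matrix.unitaryGroup (Fin n → Fin 2) ℂ := by
  induction c with
  | nil => exact one_mem _
  | cons g c ih =>
    refine mul_mem ih (mem_unitaryGroup_iff'.2 ?_)
    rw [star_eq_conjTranspose, Gate.matrix_conjTranspose, Gate.inv_matrix_mul]

theorem circuitMatrix_append (c d : Circuit n) :
    circuitMatrix (c ++ d) = circuitMatrix d * circuitMatrix c := by
  induction c with
  | nil => simp [circuitMatrix]
  | cons g c ih => simp [circuitMatrix, ih, Matrix.mul_assoc]

theorem cnotCount_append (c d : Circuit n) :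
    cnotCount (c ++ d) = cnotCount c + cnotCount d := by
  induction c with
  | nil => simp [cnotCount]
  | cons g c ih => cases g <;> simp [cnotCount, ih]; omega

theorem genericCnotCount_append (c d : GenericCircuit n) :
    genericCnotCount (c ++ d) = genericCnotCount c + genericCnotCount d := by
  induction c with
  | nil => simp [genericCnotCount]
  | cons g c ih => cases g <;> simp [genericCnotCount, ih]; omega

/-- The circuit of the inverse gates in the opposite order. -/
def inverseCircuit : Circuit n → Circuit n
  | [] => []
  | g :: c => inverseCircuit c ++ [g.inv]

theorem circuitMatrix_inverseCircuit (c : Circuit n) :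
    circuitMatrix (inverseCircuit c) = (circuitMatrix c)ᴴ := by
  induction c with
  | nil => simp [circuitMatrix, inverseCircuit]
  | cons g c ih =>
    simp [circuitMatrix, inverseCircuit, circuitMatrix_append, ih, conjTranspose_mul,
      Gate.matrix_conjTranspose]

theorem cnotCount_inverseCircuit (c : Circuit n) :
    cnotCount (inverseCircuit c) = cnotCount c := by
  induction c with
  | nil => rfl
  | cons g c ih =>
    cases g <;> simp [inverseCircuit, cnotCount_append, ih, cnotCount, Gate.inv]

/-! ### Unit vectors and the reduction to state transport -/

/-- The state vector has Euclidean length one. -/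
def IsUnitVector (v : Amplitudes n) : Prop := star v ⬝ᵥ v = 1

theorem isUnitVector_iff_norm (v : Amplitudes n) :
    IsUnitVector v ↔ ‖WithLp.toLp 2 v‖ = 1 := by
  have h : (star v ⬝ᵥ v : ℂ) = ((‖WithLp.toLp 2 v‖ ^ 2 : ℝ) : ℂ) := by
    rw [EuclideanSpace.norm_sq_eq]
    simp [dotProduct, ← Complex.conj_mul']
  rw [IsUnitVector, h]
  norm_cast
  exact pow_eq_one_iff_of_nonneg (norm_nonneg _) two_ne_zero

theorem IsUnitVector.ne_zero {v : Amplitudes n} (h : IsUnitVector v) : v ≠ 0 := by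
  rintro rfl
  simp [IsUnitVector] at h

theorem IsUnitVector.unitary_mulVec {v : Amplitudes n} (h : IsUnitVector v)
    {u : Matrix (Fin n → Fin 2) (Fin n → Fin 2) ℂ} (hu : uᴴ * u = 1) :
    IsUnitVector (u *ᵥ v) := by
  rw [IsUnitVector, star_mulVec, ← dotProduct_mulVec, mulVec_mulVec, hu, one_mulVec]
  exact h

/-- Completing a unit vector to an orthonormal basis makes it the column at index `0` of a unitary
matrix. One such matrix times the inverse of another carries `v` to `w`. -/
theorem exists_unitary_mulVec_eq {v w : Amplitudes n} (hv : IsUnitVector v)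
    (hw : IsUnitVector w) : ∃ u : Operator n, u.1 *ᵥ v = w := by
  have key : ∀ {v : Amplitudes n}, IsUnitVector v → ∃ u : Operator n, u.1 *ᵥ Pi.single 0 1 = v := by
    intro v hv
    rw [isUnitVector_iff_norm] at hv
    have ho : Orthonormal ℂ (Set.domRestrict {(0 : Fin n → Fin 2)}
        (fun _ : Fin n → Fin 2 => (WithLp.toLp 2 v : StateSpace n))) := by
      refine ⟨fun i => hv, fun i j hij => (hij ?_).elim⟩
      exact Subsingleton.elim i j
    obtain ⟨b, hb⟩ := ho.exists_orthonormalBasis_extension_of_card_eq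
      (by simp)
    refine ⟨⟨(EuclideanSpace.basisFun (Fin n → Fin 2) ℂ).toBasis.toMatrix b,
      OrthonormalBasis.toMatrix_orthonormalBasis_mem_unitary _ _⟩, ?_⟩
    funext x
    have := hb 0 rfl
    simp [Module.Basis.toMatrix_apply, this]
  obtain ⟨a, ha⟩ := key hv
  obtain ⟨b, hb⟩ := key hw
  refine ⟨b * a⁻¹, ?_⟩
  rw [← ha, ← hb, UnitaryGroup.mul_val, ← mulVec_mulVec, mulVec_mulVec _ _ a.1,
    ← UnitaryGroup.mul_val, inv_mul_cancel, UnitaryGroup.one_val, one_mulVec]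

theorem IsUnitVector.norm_eq_one_of_smul {v : Amplitudes n} (hv : IsUnitVector v) {z : ℂ}
    (h : IsUnitVector (z • v)) : ‖z‖ = 1 := by
  rw [isUnitVector_iff_norm] at h hv
  simpa [norm_smul, hv] using h

/-- Two-subspace decompositions with a one-dimensional member are given by a unit vector spanning
that member, and simulation up to the measurement says that the circuit maps `u⁻¹ ψ` to a multiple
of this vector `ψ`. -/
theorem IsLineMeasurement.exists_unit_vector
    {E : Fin 2 → Submodule ℂ (StateSpace n)} (hE : IsLineMeasurement E) :
    ∃ ψ : Amplitudes n, IsUnitVector ψ ∧ ∀ (c : Circuit n) (u : Operator n),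
      SimulatesUpToMeasurement E c u ↔
        ∃ z : ℂ, circuitMatrix c *ᵥ ((u.1)ᴴ *ᵥ ψ) = z • ψ := by
  obtain ⟨⟨horth, htop⟩, i, hi⟩ := hE
  obtain ⟨ψ', hψ', hspan⟩ := finrank_eq_one_iff'.1 hi
  have hne : (ψ' : StateSpace n) ≠ 0 := fun h => hψ' (Subtype.ext h)
  set ψ : StateSpace n := ((‖(ψ' : StateSpace n)‖⁻¹ : ℝ) : ℂ) • (ψ' : StateSpace n) with hψ
  have hnorm : ‖ψ‖ = 1 := by
    rw [hψ, norm_smul, Complex.norm_real, norm_inv, norm_norm,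
      inv_mul_cancel₀ (norm_ne_zero_iff.2 hne)]
  have hmem : ψ ∈ E i := Submodule.smul_mem _ _ ψ'.2
  have hEi : ∀ x ∈ E i, ∃ z : ℂ, x = z • ψ := by
    intro x hx
    obtain ⟨z, hz⟩ := hspan ⟨x, hx⟩
    refine ⟨z * ‖(ψ' : StateSpace n)‖, ?_⟩
    have hz' : z • (ψ' : StateSpace n) = x := congrArg Subtype.val hz
    rw [hψ, smul_smul, mul_assoc, ← Complex.ofReal_mul, mul_inv_cancel₀ (norm_ne_zero_iff.2 hne),
      Complex.ofReal_one, mul_one, hz']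
  -- One inclusion is orthogonality. For the other, a vector orthogonal to `E i` splits as `y + w`
  -- with `w ∈ E i`, and `w` is then orthogonal to itself.
  have hperp : ∀ j, j ≠ i → E j = (E i)ᗮ := by
    intro j hj
    refine le_antisymm (Submodule.isOrtho_iff_le.1 (horth j i hj)) fun x hx => ?_
    have hx' : x ∈ E j ⊔ E i := by
      have : ⨆ k, E k ≤ E j ⊔ E i := by
        refine iSup_le fun k => ?_
        by_cases hk : k = i
        · exact hk ▸ le_sup_right
        · have : k = j := by omega
          exact this ▸ le_sup_left
      exact this (htop ▸ Submodule.mem_top)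
    obtain ⟨y, hy, w, hw, rfl⟩ := Submodule.mem_sup.1 hx'
    have h1 : inner ℂ w (y + w) = 0 := (Submodule.mem_orthogonal _ _).1 hx w hw
    have h2 : inner ℂ w y = 0 := (Submodule.isOrtho_iff_inner_eq.1 (horth i j hj.symm)) w hw y hy
    rw [inner_add_right, h2, zero_add, inner_self_eq_zero] at h1
    rwa [h1, add_zero]
  have hu : IsUnitVector (ψ.ofLp) := by rw [isUnitVector_iff_norm]; exact hnorm
  refine ⟨ψ.ofLp, hu, fun c u => ⟨?_, ?_⟩⟩
  · rintro ⟨v, hv, θ, hc⟩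
    obtain ⟨z, hz⟩ := hEi _ (hv i ψ hmem)
    refine ⟨Complex.exp (θ * Complex.I) * z, ?_⟩
    have hz' : v.1 *ᵥ ψ.ofLp = z • ψ.ofLp := by
      have := congrArg WithLp.ofLp hz
      simpa using this
    rw [hc, UnitaryGroup.mul_val, smul_mulVec, ← mulVec_mulVec, mulVec_mulVec _ u.1,
      mul_smul, ← hz']
    have : u.1 * (u.1)ᴴ = 1 := mem_unitaryGroup_iff.1 u.2
    rw [this, one_mulVec]
  · rintro ⟨z, hz⟩
    -- The don't-care operator is forced once the phase is taken to be `1`. It fixes the line of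
    -- `ψ`, and being unitary it also preserves the complement.
    let v : Operator n := ⟨circuitMatrix c, circuitMatrix_mem c⟩ * u⁻¹
    have hvu : v * u = ⟨circuitMatrix c, circuitMatrix_mem c⟩ := by simp [v]
    have hvψ : v.1 *ᵥ ψ.ofLp = z • ψ.ofLp := by
      rw [← hz, mulVec_mulVec]; rfl
    have hvv : (v.1)ᴴ * v.1 = 1 := mem_unitaryGroup_iff'.1 v.2
    have hz1 : ‖z‖ = 1 :=
      hu.norm_eq_one_of_smul (hvψ ▸ hu.unitary_mulVec hvv)
    refine ⟨v, ?_, 0, by rw [hvu]; simp⟩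
    have hvE : ∀ x ∈ E i, Matrix.toEuclideanLin v.1 x ∈ E i := by
      intro x hx
      obtain ⟨w, rfl⟩ := hEi x hx
      rw [map_smul]
      have : Matrix.toEuclideanLin v.1 ψ = z • ψ := by
        apply WithLp.ofLp_injective
        simpa using hvψ
      rw [this]
      exact Submodule.smul_mem _ _ (Submodule.smul_mem _ _ hmem)
    intro j x hx
    by_cases hj : j = i
    · subst hj; exact hvE x hx
    · rw [hperp j hj, Submodule.mem_orthogonal] at hx ⊢
      intro y hy
      obtain ⟨w, rfl⟩ := hEi y hy
      have h0 : inner ℂ ψ x = 0 := hx ψ hmem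
      have h1 : inner ℂ (Matrix.toEuclideanLin v.1 ψ) (Matrix.toEuclideanLin v.1 x)
          = inner ℂ ψ x := by
        simp only [EuclideanSpace.inner_eq_star_dotProduct, Matrix.toLpLin_apply]
        rw [dotProduct_comm, star_mulVec, ← dotProduct_mulVec, mulVec_mulVec, hvv, one_mulVec,
          dotProduct_comm]
      have h2 : Matrix.toEuclideanLin v.1 ψ = z • ψ := by
        apply WithLp.ofLp_injective
        simpa using hvψ
      rw [h2, inner_smul_left, h0] at h1
      rw [inner_smul_left]
      have hz0 : z ≠ 0 := by rintro rfl; simp at hz1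
      rcases mul_eq_zero.1 h1 with h | h
      · exact absurd ((map_eq_zero _).1 h) hz0
      · rw [h, mul_zero]

theorem IsUnitVector.exists_operator {ψ φ : Amplitudes n} (hψ : IsUnitVector ψ)
    (hφ : IsUnitVector φ) : ∃ u : Operator n, (u.1)ᴴ *ᵥ ψ = φ := by
  obtain ⟨u, hu⟩ := exists_unitary_mulVec_eq hψ hφ
  exact ⟨u⁻¹, by rw [UnitaryGroup.inv_val, star_eq_conjTranspose, conjTranspose_conjTranspose, hu]⟩

theorem IsUnitVector.conjTranspose_mulVec {ψ : Amplitudes n} (hψ : IsUnitVector ψ)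
    (u : Operator n) : IsUnitVector ((u.1)ᴴ *ᵥ ψ) :=
  hψ.unitary_mulVec (by
    rw [conjTranspose_conjTranspose]; exact mem_unitaryGroup_iff.1 u.2)

/-! ### Lower bound by counting dimensions -/

/-- The matrix of a quaternion, a real multiple of an element of `SU(2)`. -/
def quaternionMatrix (w : ℂ × ℂ) : Matrix (Fin 2) (Fin 2) ℂ :=
  !![w.1, -star w.2; w.2, star w.1]

theorem quaternionMatrix_mul (w w' : ℂ × ℂ) :
    ∃ w'', quaternionMatrix w * quaternionMatrix w' = quaternionMatrix w'' := by
  refine ⟨(w.1 * w'.1 - star w.2 * w'.2, w.2 * w'.1 + star w.1 * w'.2), ?_⟩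
  ext i j
  fin_cases i <;> fin_cases j <;> simp [quaternionMatrix, Matrix.mul_apply] <;> ring

/-- Dividing by a square root `z` of the determinant lands in `SU(2)`, the unit quaternions.
Quaternions form a real vector space closed under products, so they parametrize gates without charts
on a manifold. -/
theorem OneQubit.eq_smul_quaternionMatrix (a : OneQubit) :
    ∃ (z : ℂ) (w : ℂ × ℂ), a.1 = z • quaternionMatrix w := by
  have hd : star a.1.det * a.1.det = 1 := (Unitary.mem_iff.1 (det_of_mem_unitary a.2)).1
  obtain ⟨z, hz⟩ := IsAlgClosed.exists_pow_nat_eq a.1.det (n := 2) two_pos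
  have hz1 : star z * z = 1 := by
    have h1 : ‖a.1.det‖ = 1 := by
      have := congrArg norm hd
      rw [norm_mul, norm_star, norm_one] at this
      nlinarith [norm_nonneg a.1.det]
    have h2 : ‖z‖ = 1 := by
      rw [← hz, norm_pow] at h1
      exact (pow_eq_one_iff_of_nonneg (norm_nonneg _) two_ne_zero).1 h1
    have := Complex.conj_mul' z
    rw [h2] at this
    simpa using this
  have hadj : a.1.adjugate = a.1.det • (a.1)ᴴ := by
    have h : a.1 * (a.1)ᴴ = 1 := mem_unitaryGroup_iff.1 a.2
    calc a.1.adjugate = a.1.adjugate * (a.1 * (a.1)ᴴ) := by rw [h, Matrix.mul_one]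
      _ = a.1.det • (a.1)ᴴ := by
        rw [← Matrix.mul_assoc, adjugate_mul, smul_mul, Matrix.one_mul]
  rw [adjugate_fin_two] at hadj
  have h00 := congrFun (congrFun hadj 0) 0
  have h01 := congrFun (congrFun hadj 0) 1
  simp only [of_apply, cons_val', cons_val_zero, cons_val_one, cons_val_fin_one,
    Matrix.smul_apply, conjTranspose_apply, smul_eq_mul, ← hz] at h00 h01
  have e00 : z * (star z * a.1 0 0) = a.1 0 0 := by linear_combination a.1 0 0 * hz1
  have e10 : z * (star z * a.1 1 0) = a.1 1 0 := by linear_combination a.1 1 0 * hz1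
  refine ⟨z, (star z * a.1 0 0, star z * a.1 1 0), ?_⟩
  ext i j
  fin_cases i <;> fin_cases j <;>
    simp only [quaternionMatrix, Fin.zero_eta, Fin.mk_one, Matrix.smul_apply, of_apply,
      cons_val', cons_val_zero, cons_val_one, cons_val_fin_one, smul_eq_mul, e00, e10,
      star_mul, star_star]
  · linear_combination -h01
  · linear_combination h00

/-- The vectors obtained from multiples of `ψ` by quaternions on the qubits of a list. -/
def layerSet (ψ : Amplitudes n) : List (Fin n) → Set (Amplitudes n)
  | [] => {v | ∃ z : ℂ, v = z • ψ}
  | q :: l => {v | ∃ w, ∃ v' ∈ layerSet ψ l, v = applyQubit q (quaternionMatrix w) v'}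

/-- The vectors obtained from multiples of `ψ` by a quaternion on each qubit, and then CNOTs on
the pairs of qubits of a list, each followed by two quaternions on the same qubits. -/
def reachableSet (ψ : Amplitudes n) : List (Fin n × Fin n) → Set (Amplitudes n)
  | [] => layerSet ψ (List.finRange n)
  | p :: L => {v | ∃ w w', ∃ v' ∈ reachableSet ψ L, v = applyQubit p.1 (quaternionMatrix w)
      (applyQubit p.2 (quaternionMatrix w') (applyCnot p.1 p.2 v'))}

theorem smul_mem_layerSet {ψ : Amplitudes n} {l : List (Fin n)} {v : Amplitudes n}
    (hv : v ∈ layerSet ψ l) (z : ℂ) : z • v ∈ layerSet ψ l := by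
  induction l generalizing v with
  | nil =>
    obtain ⟨y, rfl⟩ := hv
    exact ⟨z * y, smul_smul _ _ _⟩
  | cons q l ih =>
    obtain ⟨w, v', hv', rfl⟩ := hv
    exact ⟨w, _, ih hv', (applyQubit_smul _ _ _ _).symm⟩

theorem smul_mem_reachableSet {ψ : Amplitudes n} {L : List (Fin n × Fin n)} {v : Amplitudes n}
    (hv : v ∈ reachableSet ψ L) (z : ℂ) : z • v ∈ reachableSet ψ L := by
  induction L generalizing v with
  | nil => exact smul_mem_layerSet hv z
  | cons q l ih =>
    obtain ⟨w, w', v', hv', rfl⟩ := hv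
    exact ⟨w, w', _, ih hv', by rw [applyCnot_smul, applyQubit_smul, applyQubit_smul]⟩

theorem applyQubit_mem_layerSet {ψ : Amplitudes n} {l : List (Fin n)} {v : Amplitudes n}
    (hv : v ∈ layerSet ψ l) {q : Fin n} (hq : q ∈ l) (w : ℂ × ℂ) :
    applyQubit q (quaternionMatrix w) v ∈ layerSet ψ l := by
  induction l generalizing v with
  | nil => simp at hq
  | cons r l ih =>
    obtain ⟨w', v', hv', rfl⟩ := hv
    by_cases h : q = r
    · subst h
      obtain ⟨w'', hw''⟩ := quaternionMatrix_mul w w'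
      exact ⟨w'', v', hv', by rw [applyQubit_mul, hw'']⟩
    · exact ⟨w', _, ih hv' ((List.mem_cons.1 hq).resolve_left h), applyQubit_comm h _ _ _⟩

/-- A quaternion on `q` commutes past every layer not touching `q` and is absorbed by the first
quaternion on `q` that it meets, so one-qubit gates add no parameters. -/
theorem applyQubit_mem_reachableSet {ψ : Amplitudes n} {L : List (Fin n × Fin n)}
    {v : Amplitudes n} (hv : v ∈ reachableSet ψ L) (q : Fin n) (w : ℂ × ℂ) :
    applyQubit q (quaternionMatrix w) v ∈ reachableSet ψ L := by
  induction L generalizing v with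
  | nil => exact applyQubit_mem_layerSet hv (List.mem_finRange q) w
  | cons p L ih =>
    obtain ⟨w₁, w₂, v', hv', rfl⟩ := hv
    by_cases h1 : q = p.1
    · obtain ⟨w₃, hw₃⟩ := quaternionMatrix_mul w w₁
      exact ⟨w₃, w₂, v', hv', by rw [← h1, applyQubit_mul, hw₃]⟩
    by_cases h2 : q = p.2
    · obtain ⟨w₃, hw₃⟩ := quaternionMatrix_mul w w₂
      exact ⟨w₁, w₃, v', hv', by rw [applyQubit_comm h1, ← h2, applyQubit_mul, hw₃]⟩
    · exact ⟨w₁, w₂, _, ih hv', by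
        rw [applyQubit_comm h1, applyQubit_comm h2, applyQubit_applyCnot h1 h2]⟩

theorem applyOneQubit_mem_reachableSet {ψ : Amplitudes n} {L : List (Fin n × Fin n)}
    {v : Amplitudes n} (hv : v ∈ reachableSet ψ L) (q : Fin n) (a : OneQubit) :
    applyQubit q a.1 v ∈ reachableSet ψ L := by
  obtain ⟨z, w, h⟩ := a.eq_smul_quaternionMatrix
  rw [h, smul_applyQubit]
  exact smul_mem_reachableSet (applyQubit_mem_reachableSet hv q w) z

theorem quaternionMatrix_one : quaternionMatrix (1, 0) = 1 := by
  ext i j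
  fin_cases i <;> fin_cases j <;> simp [quaternionMatrix]

theorem mem_layerSet (ψ : Amplitudes n) (l : List (Fin n)) : ψ ∈ layerSet ψ l := by
  induction l with
  | nil => exact ⟨1, (one_smul _ _).symm⟩
  | cons q l ih => exact ⟨(1, 0), ψ, ih, by rw [quaternionMatrix_one, applyQubit_one]⟩

/-- The adjoint applies the inverse gates in reverse order, so the head of `c` acts last and its
CNOT becomes the head of `L`. -/
theorem conjTranspose_circuitMatrix_mulVec_mem (ψ : Amplitudes n) (c : Circuit n) :
    ∃ L : List (Fin n × Fin n), L.length = cnotCount c ∧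
      (circuitMatrix c)ᴴ *ᵥ ψ ∈ reachableSet ψ L := by
  induction c with
  | nil => exact ⟨[], rfl, by simpa [circuitMatrix, reachableSet] using mem_layerSet ψ (List.finRange n)⟩
  | cons g c ih =>
    obtain ⟨L, hL, hmem⟩ := ih
    rw [circuitMatrix, conjTranspose_mul, ← mulVec_mulVec, Gate.matrix_conjTranspose]
    cases g with
    | oneQubit q a =>
      refine ⟨L, hL, ?_⟩
      rw [Gate.inv, Gate.matrix, oneQubitMatrix_mulVec]
      exact applyOneQubit_mem_reachableSet hmem _ _
    | cnot r t h =>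
      refine ⟨(r, t) :: L, by simp [cnotCount, hL], ?_⟩
      rw [Gate.inv, Gate.matrix, cnotMatrix_mulVec h]
      exact ⟨(1, 0), (1, 0), _, hmem, by simp only [quaternionMatrix_one, applyQubit_one]⟩

/-- The set is covered by a `C¹` image of a real vector space of dimension `m`. -/
def HasSmoothCover (m : ℕ) (S : Set (Amplitudes n)) : Prop :=
  ∃ (P : Type) (_ : NormedAddCommGroup P) (_ : NormedSpace ℝ P) (_ : FiniteDimensional ℝ P)
    (f : P → Amplitudes n), Module.finrank ℝ P = m ∧ ContDiff ℝ 1 f ∧ S ⊆ Set.range f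

theorem HasSmoothCover.dimH_le {m : ℕ} {S : Set (Amplitudes n)} (h : HasSmoothCover m S) :
    dimH S ≤ m := by
  obtain ⟨P, _, _, _, f, hm, hf, hS⟩ := h
  exact (dimH_mono hS).trans (hm ▸ hf.dimH_range_le)

theorem contDiff_quaternionMatrix {P : Type} [NormedAddCommGroup P] [NormedSpace ℝ P]
    {g : P → ℂ × ℂ} (hg : ContDiff ℝ 1 g) (i j : Fin 2) :
    ContDiff ℝ 1 fun p => quaternionMatrix (g p) i j := by
  have h1 : ContDiff ℝ 1 fun p => (g p).1 := hg.fst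
  have h2 : ContDiff ℝ 1 fun p => (g p).2 := hg.snd
  -- Conjugation is smooth only over `ℝ`, hence the real parameter spaces.
  have hc : ContDiff ℝ 1 (fun z : ℂ => star z) := Complex.conjCLE.contDiff
  fin_cases i <;> fin_cases j
  · exact h1
  · exact (hc.comp h2).neg
  · exact h2
  · exact hc.comp h1

theorem contDiff_applyQubit {P : Type} [NormedAddCommGroup P] [NormedSpace ℝ P]
    {g : P → ℂ × ℂ} (hg : ContDiff ℝ 1 g) {f : P → Amplitudes n} (hf : ContDiff ℝ 1 f)
    (q : Fin n) : ContDiff ℝ 1 fun p => applyQubit q (quaternionMatrix (g p)) (f p) := by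
  refine contDiff_pi.2 fun x => ?_
  simp only [applyQubit]
  refine ContDiff.sum fun b _ => (contDiff_quaternionMatrix hg _ _).mul ?_
  exact contDiff_pi.1 hf _

/-- The scalar contributes `2` real parameters and each quaternion `4`. -/
theorem hasSmoothCover_layerSet (ψ : Amplitudes n) (l : List (Fin n)) :
    HasSmoothCover (2 + 4 * l.length) (layerSet ψ l) := by
  induction l with
  | nil =>
    refine ⟨ℂ, inferInstance, inferInstance, inferInstance, fun z => z • ψ,
      Complex.finrank_real_complex, ?_, ?_⟩
    · exact contDiff_id.smul contDiff_const
    · rintro v ⟨z, rfl⟩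
      exact ⟨z, rfl⟩
  | cons q l ih =>
    obtain ⟨P, _, _, _, f, hm, hf, hS⟩ := ih
    refine ⟨P × (ℂ × ℂ), inferInstance, inferInstance, inferInstance,
      fun p => applyQubit q (quaternionMatrix p.2) (f p.1), ?_,
      contDiff_applyQubit contDiff_snd (hf.comp contDiff_fst) q, ?_⟩
    · simp only [Module.finrank_prod, hm, Complex.finrank_real_complex, List.length_cons]
      ring
    · rintro v ⟨w, v', hv', rfl⟩
      obtain ⟨p, rfl⟩ := hS hv'
      exact ⟨(p, w), rfl⟩

theorem hasSmoothCover_reachableSet (ψ : Amplitudes n) (L : List (Fin n × Fin n)) :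
    HasSmoothCover (2 + 4 * n + 8 * L.length) (reachableSet ψ L) := by
  induction L with
  | nil => simpa [reachableSet] using hasSmoothCover_layerSet ψ (List.finRange n)
  | cons q l ih =>
    obtain ⟨P, _, _, _, f, hm, hf, hS⟩ := ih
    refine ⟨P × ((ℂ × ℂ) × (ℂ × ℂ)), inferInstance, inferInstance, inferInstance,
      fun p => applyQubit q.1 (quaternionMatrix p.2.1)
        (applyQubit q.2 (quaternionMatrix p.2.2) (applyCnot q.1 q.2 (f p.1))), ?_,
      contDiff_applyQubit contDiff_snd.fst
        (contDiff_applyQubit contDiff_snd.snd ?_ _) _, ?_⟩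
    · simp only [Module.finrank_prod, hm, Complex.finrank_real_complex, List.length_cons]
      ring
    · exact contDiff_pi.2 fun x => contDiff_pi.1 (hf.comp contDiff_fst) _
    · rintro v ⟨w, w', v', hv', rfl⟩
      obtain ⟨p, rfl⟩ := hS hv'
      exact ⟨(p, w, w'), rfl⟩

/-- Counting dimensions: some unit vector cannot be obtained from `ψ` by few CNOTs. -/
theorem exists_isUnitVector_not_reachable (ψ : Amplitudes n) (m : ℕ)
    (hm : 2 + 4 * n + 8 * m < 2 * 2 ^ n) :
    ∃ φ : Amplitudes n, IsUnitVector φ ∧ ∀ L : List (Fin n × Fin n), L.length ≤ m →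
      φ ∉ reachableSet ψ L := by
  let S : Set (Amplitudes n) := ⋃ L : {L : List (Fin n × Fin n) // L.length ≤ m},
    reachableSet ψ L.1
  -- There are only countably many lists, so the dimension of the union is the supremum of the
  -- dimensions.
  have hS : dimH S < Module.finrank ℝ (Amplitudes n) := by
    have h1 : dimH S ≤ ((2 + 4 * n + 8 * m : ℕ) : ENNReal) := by
      rw [dimH_iUnion]
      refine iSup_le fun L => (hasSmoothCover_reachableSet ψ L.1).dimH_le.trans ?_
      have := L.2
      exact_mod_cast (by omega : 2 + 4 * n + 8 * L.1.length ≤ 2 + 4 * n + 8 * m)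
    refine h1.trans_lt ?_
    have : Module.finrank ℝ (Amplitudes n) = 2 * 2 ^ n := by
      rw [Module.finrank_pi_fintype]
      simp [mul_comm]
    rw [this]
    exact_mod_cast hm
  obtain ⟨φ, hφ⟩ := (dense_compl_of_dimH_lt_finrank hS).nonempty
  have hφ' : ∀ L : List (Fin n × Fin n), L.length ≤ m → φ ∉ reachableSet ψ L :=
    fun L hL h => hφ (Set.mem_iUnion.2 ⟨⟨L, hL⟩, h⟩)
  -- The reachable sets are cones containing `0`; hence `φ` is nonzero, and normalizing it keeps it
  -- outside them.
  have h0 : φ ≠ 0 := by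
    rintro rfl
    refine hφ' [] (Nat.zero_le _) ?_
    simpa [reachableSet] using smul_mem_layerSet (mem_layerSet ψ (List.finRange n)) 0
  have hn : ‖WithLp.toLp 2 φ‖ ≠ 0 := by simpa using h0
  refine ⟨((‖WithLp.toLp 2 φ‖⁻¹ : ℝ) : ℂ) • φ, ?_, fun L hL h => hφ' L hL ?_⟩
  · rw [isUnitVector_iff_norm, WithLp.toLp_smul, norm_smul, Complex.norm_real, norm_inv, norm_norm,
      inv_mul_cancel₀ hn]
  · have := smul_mem_reachableSet h (‖WithLp.toLp 2 φ‖ : ℂ)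
    rwa [smul_smul, ← Complex.ofReal_mul, mul_inv_cancel₀ hn, Complex.ofReal_one, one_smul] at this

theorem mulVec_eq_smul_imp {c : Circuit n} {φ ψ : Amplitudes n} {z : ℂ}
    (h : circuitMatrix c *ᵥ φ = z • ψ) : φ = z • ((circuitMatrix c)ᴴ *ᵥ ψ) := by
  have hu : (circuitMatrix c)ᴴ * circuitMatrix c = 1 := mem_unitaryGroup_iff'.1 (circuitMatrix_mem c)
  rw [← mulVec_smul, ← h, mulVec_mulVec, hu, one_mulVec]

theorem exists_operator_cnotCount_lower_bound (E : Fin 2 → Submodule ℂ (StateSpace n))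
    (hE : IsLineMeasurement E) :
    ∃ u : Operator n, ∀ c : Circuit n, SimulatesUpToMeasurement E c u →
      ⌈((2 : ℝ) ^ n - 3 * (n : ℝ) - 1) / 4⌉ ≤ (cnotCount c : ℤ) := by
  obtain ⟨ψ, hψ, hsim⟩ := hE.exists_unit_vector
  rcases le_or_gt ⌈((2 : ℝ) ^ n - 3 * (n : ℝ) - 1) / 4⌉ 0 with h0 | h0
  · exact ⟨1, fun c _ => h0.trans (by positivity)⟩
  obtain ⟨m, hm⟩ : ∃ m : ℕ, ⌈((2 : ℝ) ^ n - 3 * (n : ℝ) - 1) / 4⌉ = m + 1 :=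
    ⟨(⌈((2 : ℝ) ^ n - 3 * (n : ℝ) - 1) / 4⌉ - 1).toNat, by omega⟩
  have hlt : (m : ℝ) < ((2 : ℝ) ^ n - 3 * (n : ℝ) - 1) / 4 := by
    have := Int.lt_ceil.1 (show (m : ℤ) < ⌈((2 : ℝ) ^ n - 3 * (n : ℝ) - 1) / 4⌉ by omega)
    exact_mod_cast this
  have hlt' : 4 * m + 3 * n + 1 < 2 ^ n := by
    have : (4 * m + 3 * n + 1 : ℝ) < 2 ^ n := by linarith
    exact_mod_cast this
  -- The count needs only `4m + 2n + 1 < 2 ^ n`. This slack of `n` is why the norms of the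
  -- quaternions may be counted as superfluous parameters.
  obtain ⟨φ, hφ, hL⟩ := exists_isUnitVector_not_reachable ψ m (by omega)
  obtain ⟨u, hu⟩ := hψ.exists_operator hφ
  refine ⟨u, fun c hc => ?_⟩
  obtain ⟨z, hz⟩ := (hsim c u).1 hc
  rw [hu] at hz
  obtain ⟨L, hlen, hmem⟩ := conjTranspose_circuitMatrix_mulVec_mem ψ c
  by_contra hcount
  refine hL L (by omega) ?_
  rw [mulVec_eq_smul_imp hz]
  exact smul_mem_reachableSet hmem z

/-! ### Upper bound by multiplexed rotations -/

/-- A one-parameter family of one-qubit gates that conjugation by NOT inverts. -/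
structure IsRotationFamily (G : ℝ → OneQubit) : Prop where
  add (a b : ℝ) : G (a + b) = G a * G b
  neg (a : ℝ) (i j : Fin 2) : (G (-a)).1 i j = (G a).1 (i + 1) (j + 1)

/-- The rotation by a multiple of the Pauli matrix `Z`. -/
noncomputable def rotationZ (θ : ℝ) : OneQubit :=
  ⟨!![Complex.exp (-(θ * Complex.I)), 0; 0, Complex.exp (θ * Complex.I)], by
    rw [mem_unitaryGroup_iff]
    ext i j
    fin_cases i <;> fin_cases j <;>
      simp [Matrix.mul_apply, star_eq_conjTranspose, ← Complex.exp_conj, ← Complex.exp_add]⟩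

/-- The rotation by a multiple of the Pauli matrix `Y`. -/
noncomputable def rotationY (θ : ℝ) : OneQubit :=
  ⟨!![(Real.cos θ : ℂ), -(Real.sin θ : ℂ); (Real.sin θ : ℂ), (Real.cos θ : ℂ)], by
    rw [mem_unitaryGroup_iff]
    have h : (Real.cos θ : ℂ) * Real.cos θ + Real.sin θ * Real.sin θ = 1 := by
      have := Real.cos_sq_add_sin_sq θ
      rw [sq, sq] at this
      exact_mod_cast this
    generalize Real.cos θ = c at h
    generalize Real.sin θ = s at h
    ext i j
    fin_cases i <;> fin_cases j <;> simp [Matrix.mul_apply, star_eq_conjTranspose] <;>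
      first | linear_combination h | ring⟩

theorem isRotationFamily_rotationZ : IsRotationFamily rotationZ where
  add a b := by
    apply Subtype.ext
    ext i j
    fin_cases i <;> fin_cases j <;>
      simp [rotationZ, ← Complex.exp_add, add_mul, add_comm]
  neg a i j := by
    fin_cases i <;> fin_cases j <;> simp [rotationZ]

theorem isRotationFamily_rotationY : IsRotationFamily rotationY where
  add a b := by
    apply Subtype.ext
    ext i j
    fin_cases i <;> fin_cases j <;>
      simp [rotationY, Complex.cos_add, Complex.sin_add] <;> ring
  neg a i j := by
    fin_cases i <;> fin_cases j <;> simp [rotationY]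

/-- The Z-rotation gives `α` and `β` the common phase `(p + q) / 2`, the mean of their arguments.
The Y-rotation then turns the real vector `(‖α‖, ‖β‖)` onto the first axis. -/
theorem exists_rotation_apply_one_eq_zero (α β : ℂ) : ∃ a b : ℝ,
    (rotationY b * rotationZ a).1 1 0 * α + (rotationY b * rotationZ a).1 1 1 * β = 0 := by
  obtain ⟨a, b, h⟩ : ∃ a b : ℝ, (Real.sin b : ℂ) * (Complex.exp (-(a * Complex.I)) * α) +
      Real.cos b * (Complex.exp (a * Complex.I) * β) = 0 := by
    set p := Complex.arg α
    set q := Complex.arg β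
    have hα : Complex.exp (-(((p - q) / 2 : ℝ) * Complex.I)) * α =
        ‖α‖ * Complex.exp (((p + q) / 2 : ℝ) * Complex.I) := by
      nth_rewrite 1 [← Complex.norm_mul_exp_arg_mul_I α]
      rw [mul_left_comm, ← Complex.exp_add]
      congr 2
      push_cast
      ring
    have hβ : Complex.exp (((p - q) / 2 : ℝ) * Complex.I) * β =
        ‖β‖ * Complex.exp (((p + q) / 2 : ℝ) * Complex.I) := by
      nth_rewrite 1 [← Complex.norm_mul_exp_arg_mul_I β]
      rw [mul_left_comm, ← Complex.exp_add]
      congr 2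
      push_cast
      ring
    obtain ⟨b, hb⟩ : ∃ b : ℝ, Real.sin b * ‖α‖ + Real.cos b * ‖β‖ = 0 := by
      by_cases h : ‖α‖ = 0
      · exact ⟨Real.pi / 2, by simp [h]⟩
      · refine ⟨-Real.arctan (‖β‖ / ‖α‖), ?_⟩
        have hc : Real.cos (Real.arctan (‖β‖ / ‖α‖)) ≠ 0 := (Real.cos_arctan_pos _).ne'
        have ht := Real.tan_arctan (‖β‖ / ‖α‖)
        rw [Real.tan_eq_sin_div_cos, div_eq_div_iff hc h] at ht
        rw [Real.sin_neg, Real.cos_neg]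
        linarith
    refine ⟨(p - q) / 2, b, ?_⟩
    rw [hα, hβ]
    have hb' : (Real.sin b : ℂ) * ‖α‖ + Real.cos b * ‖β‖ = 0 := by exact_mod_cast hb
    linear_combination Complex.exp (((p + q) / 2 : ℝ) * Complex.I) * hb'
  refine ⟨a, b, ?_⟩
  rw [← h, UnitaryGroup.mul_val]
  simp [rotationY, rotationZ, Matrix.mul_apply]
  ring

/-- The uniformly controlled one-qubit operator: `a x` acts on qubit `t` of the basis vectors with
bits `x`. -/
def applyMultiplexed (t : Fin n) (a : (Fin n → Fin 2) → OneQubit) (v : Amplitudes n) :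
    Amplitudes n :=
  fun x => applyQubit t (a x).1 v x

theorem applyMultiplexed_applyMultiplexed (t : Fin n) (a b : (Fin n → Fin 2) → OneQubit)
    (hb : ∀ x i, b (update x t i) = b x) (v : Amplitudes n) :
    applyMultiplexed t a (applyMultiplexed t b v) = applyMultiplexed t (fun x => a x * b x) v := by
  funext x
  have := congrFun (applyQubit_mul t (a x).1 (b x).1 v) x
  rw [applyMultiplexed, applyMultiplexed, UnitaryGroup.mul_val, ← this]
  simp only [applyQubit, applyMultiplexed, hb]

/-- Where the control bit is `1`, the two CNOTs conjugate the rotation by NOT, which inverts it;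
where it is `0` they do nothing. -/
theorem applyCnot_applyMultiplexed_applyCnot {G : ℝ → OneQubit} (hG : IsRotationFamily G)
    {c t : Fin n} (h : c ≠ t) (θ : (Fin n → Fin 2) → ℝ) (hθ : ∀ x i, θ (update x t i) = θ x)
    (v : Amplitudes n) :
    applyCnot c t (applyMultiplexed t (fun x => G (θ x)) (applyCnot c t v)) =
      applyMultiplexed t (fun x => G (if x c = 0 then θ x else -θ x)) v := by
  funext x
  simp only [applyCnot, applyMultiplexed, applyQubit, hθ, update_self, update_idem,
    update_of_ne h]
  by_cases hx : x c = 0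
  · simp [hx]
  · have hx1 : x c = 1 := by omega
    simp only [hx1, one_ne_zero, if_false, hG.neg]
    exact Fintype.sum_equiv (Equiv.addRight 1) _ _ fun b => by
      simp [fin_two_add_add_cancel]

theorem forall₂_append {α β : Type*} {R : α → β → Prop} {l₁ l₂ : List α} {m₁ m₂ : List β}
    (h₁ : List.Forall₂ R l₁ m₁) (h₂ : List.Forall₂ R l₂ m₂) :
    List.Forall₂ R (l₁ ++ l₂) (m₁ ++ m₂) := List.rel_append h₁ h₂

/-- One more control costs two copies of the circuit and two CNOTs, so the count `N k` satisfies `N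
(k + 1) = 2 * N k + 2`. Adding `2` to the count makes the bound exactly double. -/
theorem exists_genericCircuit_multiplexed {G : ℝ → OneQubit} (hG : IsRotationFamily G)
    (t : Fin n) (k : ℕ) (hk : k ≤ t.val) :
    ∃ T : GenericCircuit n, genericCnotCount T + 2 ≤ 2 * 2 ^ k ∧
      ∀ θ : (Fin n → Fin 2) → ℝ, (∀ x y, (∀ j : Fin n, j.val < k → x j = y j) → θ x = θ y) →
        ∃ c : Circuit n, List.Forall₂ GenericGate.Specializes T c ∧
          ∀ v, circuitMatrix c *ᵥ v = applyMultiplexed t (fun x => G (θ x)) v := by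
  induction k with
  | zero =>
    refine ⟨[.placeholder t Set.univ], by simp [genericCnotCount], fun θ hθ => ?_⟩
    refine ⟨[.oneQubit t (G (θ 0))], .cons (.placeholder _ _ _ (Set.mem_univ _)) .nil, fun v => ?_⟩
    rw [circuitMatrix, circuitMatrix, Matrix.one_mul, Gate.matrix, oneQubitMatrix_mulVec]
    funext x
    rw [applyMultiplexed, hθ x 0 (by simp)]
  | succ k ih =>
    obtain ⟨T, hT, hspec⟩ := ih (by omega)
    let q : Fin n := ⟨k, by omega⟩
    have hq : q ≠ t := by
      intro h
      have : k = t.val := congrArg Fin.val h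
      omega
    refine ⟨T ++ ([.cnot q t hq] ++ (T ++ [.cnot q t hq])), ?_, fun θ hθ => ?_⟩
    · simp only [genericCnotCount_append, genericCnotCount, pow_succ]
      omega
    have hdep : ∀ (i : Fin 2) (x y : Fin n → Fin 2), (∀ j : Fin n, j.val < k → x j = y j) →
        θ (update x q i) = θ (update y q i) := by
      intro i x y h
      refine hθ _ _ fun j hj => ?_
      by_cases hjq : j = q
      · subst hjq; simp
      · have : j.val ≠ k := fun e => hjq (Fin.ext e)
        rw [update_of_ne hjq, update_of_ne hjq, h j (by omega)]
    -- The half sum and half difference of the angles for control bit `0` and `1`: their sum and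
    -- difference recover the two angles.
    obtain ⟨c₁, hc₁, h₁⟩ := hspec (fun x => (θ (update x q 0) + θ (update x q 1)) / 2)
      fun x y h => by simp only [hdep _ x y h]
    obtain ⟨c₂, hc₂, h₂⟩ := hspec (fun x => (θ (update x q 0) - θ (update x q 1)) / 2)
      fun x y h => by simp only [hdep _ x y h]
    refine ⟨c₁ ++ ([.cnot q t hq] ++ (c₂ ++ [.cnot q t hq])), ?_, fun v => ?_⟩
    · have hcn := List.Forall₂.cons (GenericGate.Specializes.cnot q t hq) List.Forall₂.nil
      exact forall₂_append hc₁ (forall₂_append hcn (forall₂_append hc₂ hcn))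
    · have hinv : ∀ (i : Fin 2) (x : Fin n → Fin 2) (b : Fin 2),
          θ (update (update x t b) q i) = θ (update x q i) := by
        refine fun i x b => hdep i _ _ fun j hj => update_of_ne ?_ _ _
        intro h
        have := congrArg Fin.val h
        omega
      simp only [circuitMatrix_append, ← mulVec_mulVec, h₁, h₂, circuitMatrix, one_mulVec,
        Gate.matrix, cnotMatrix_mulVec hq]
      rw [applyCnot_applyMultiplexed_applyCnot hG hq _ (by simp [hinv]),
        applyMultiplexed_applyMultiplexed _ _ _ (by simp [hinv])]
      funext x
      simp only [applyMultiplexed, ← hG.add]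
      have hx : (if x q = 0 then (θ (update x q 0) - θ (update x q 1)) / 2
          else -((θ (update x q 0) - θ (update x q 1)) / 2)) +
          (θ (update x q 0) + θ (update x q 1)) / 2 = θ x := by
        by_cases h0 : x q = 0
        · rw [if_pos h0, ← h0, update_eq_self]; ring
        · have h1 : x q = 1 := by omega
          rw [if_neg h0, ← h1, update_eq_self]; ring
      rw [hx]

/-- The amplitudes vanish unless all qubits from the `m`-th on are `0`. -/
def IsDisentangledFrom (m : ℕ) (v : Amplitudes n) : Prop :=
  ∀ x : Fin n → Fin 2, ∀ j : Fin n, m ≤ j.val → x j ≠ 0 → v x = 0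

theorem exists_genericCircuit_disentangle_qubit (t : Fin n) :
    ∃ T : GenericCircuit n, genericCnotCount T ≤ 4 * 2 ^ t.val ∧
      ∀ v : Amplitudes n, IsDisentangledFrom (t.val + 1) v → ∃ c : Circuit n,
        List.Forall₂ GenericGate.Specializes T c ∧
          IsDisentangledFrom t.val (circuitMatrix c *ᵥ v) := by
  obtain ⟨Tz, hTz, hz⟩ :=
    exists_genericCircuit_multiplexed isRotationFamily_rotationZ t t.val le_rfl
  obtain ⟨Ty, hTy, hy⟩ :=
    exists_genericCircuit_multiplexed isRotationFamily_rotationY t t.val le_rfl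
  refine ⟨Tz ++ Ty, by rw [genericCnotCount_append]; omega, fun v hv => ?_⟩
  choose a b hab using exists_rotation_apply_one_eq_zero
  -- Clearing the bits from `t` on makes the angles depend on the controls alone. Since `v` is
  -- supported where later bits vanish, `r x` and `update (r x) t 1` index the only pair of
  -- amplitudes that matters.
  let r : (Fin n → Fin 2) → (Fin n → Fin 2) := fun x j => if j.val < t.val then x j else 0
  have hr : ∀ x y : Fin n → Fin 2, (∀ j : Fin n, j.val < t.val → x j = y j) → r x = r y := by
    intro x y h
    funext j
    simp only [r]
    split_ifs with hj
    · exact h j hj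
    · rfl
  have hrt : ∀ x i, r (update x t i) = r x := by
    refine fun x i => hr _ _ fun j hj => update_of_ne ?_ _ _
    rintro rfl
    exact lt_irrefl _ hj
  obtain ⟨cz, hcz, hz'⟩ := hz (fun x => a (v (r x)) (v (update (r x) t 1)))
    fun x y h => by simp only [hr x y h]
  obtain ⟨cy, hcy, hy'⟩ := hy (fun x => b (v (r x)) (v (update (r x) t 1)))
    fun x y h => by simp only [hr x y h]
  refine ⟨cz ++ cy, forall₂_append hcz hcy, fun x j hj hxj => ?_⟩
  rw [circuitMatrix_append, ← mulVec_mulVec, hz', hy',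
    applyMultiplexed_applyMultiplexed _ _ _ (by simp [hrt])]
  -- With a nonzero bit beyond `t`, both amplitudes that the gate mixes are already `0`.
  by_cases hfar : ∃ i : Fin n, t.val < i.val ∧ x i ≠ 0
  · obtain ⟨i, hi, hxi⟩ := hfar
    have hit : i ≠ t := by rintro rfl; exact lt_irrefl _ hi
    have : ∀ s, v (update x t s) = 0 := fun s => hv _ i hi (by rwa [update_of_ne hit])
    simp [applyMultiplexed, applyQubit, this]
  · push Not at hfar
    have hjt : j = t := by
      by_contra hne
      exact hxj (hfar j (lt_of_le_of_ne hj fun e => hne (Fin.ext e.symm)))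
    subst hjt
    have hx1 : x j = 1 := by omega
    have hup : ∀ s, update x j s = update (r x) j s := by
      intro s
      funext i
      by_cases hi : i = j
      · subst hi; simp
      · rw [update_of_ne hi, update_of_ne hi]
        simp only [r]
        split_ifs with hlt
        · rfl
        · exact hfar i (lt_of_le_of_ne (not_lt.1 hlt) fun e => hi (Fin.ext e.symm))
    have hr0 : update (r x) j 0 = r x := by
      rw [update_eq_iff]
      simp [r]
    simp only [applyMultiplexed, applyQubit, Fin.sum_univ_two, hx1, hup, hr0]
    exact hab _ _

theorem exists_genericCircuit_disentangle (m : ℕ) (hm : m ≤ n) :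
    ∃ T : GenericCircuit n, genericCnotCount T ≤ 4 * 2 ^ m ∧
      ∀ v : Amplitudes n, IsDisentangledFrom m v → ∃ c : Circuit n,
        List.Forall₂ GenericGate.Specializes T c ∧
          IsDisentangledFrom 0 (circuitMatrix c *ᵥ v) := by
  induction m with
  | zero =>
    exact ⟨[], by simp [genericCnotCount], fun v hv => ⟨[], .nil, by simpa [circuitMatrix]⟩⟩
  | succ m ih =>
    obtain ⟨T, hT, h⟩ := ih (by omega)
    obtain ⟨T', hT', h'⟩ := exists_genericCircuit_disentangle_qubit (⟨m, hm⟩ : Fin n)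
    simp only at hT' h'
    refine ⟨T' ++ T, ?_, fun v hv => ?_⟩
    · rw [genericCnotCount_append, pow_succ]
      omega
    obtain ⟨c', hc', hd'⟩ := h' v hv
    obtain ⟨c, hc, hd⟩ := h _ hd'
    exact ⟨c' ++ c, forall₂_append hc' hc, by
      rwa [circuitMatrix_append, ← mulVec_mulVec]⟩

/-- A circuit as a generic circuit with a single specialization. -/
def Gate.toGeneric : Gate n → GenericGate n
  | .oneQubit q a => .placeholder q {a}
  | .cnot c t h => .cnot c t h

theorem forall₂_specializes_toGeneric (c : Circuit n) :
    List.Forall₂ GenericGate.Specializes (c.map Gate.toGeneric) c := by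
  induction c with
  | nil => exact .nil
  | cons g c ih =>
    refine .cons ?_ ih
    cases g
    · exact .placeholder _ _ _ rfl
    · exact .cnot _ _ _

theorem genericCnotCount_of_specializes {T : GenericCircuit n} {c : Circuit n}
    (h : List.Forall₂ GenericGate.Specializes T c) : genericCnotCount T = cnotCount c := by
  induction h with
  | nil => rfl
  | cons hg _ ih => cases hg <;> simp [genericCnotCount, cnotCount, ih]

theorem IsDisentangledFrom.eq_smul {v : Amplitudes n} (h : IsDisentangledFrom 0 v) :
    v = v 0 • Pi.single 0 1 := by
  funext x
  by_cases hx : x = 0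
  · subst hx; simp
  · obtain ⟨j, hj⟩ := Function.ne_iff.1 hx
    rw [h x j (Nat.zero_le _) hj]
    simp [Pi.single_eq_of_ne hx]

theorem exists_genericCircuit_universal (E : Fin 2 → Submodule ℂ (StateSpace n))
    (hE : IsLineMeasurement E) :
    ∃ T : GenericCircuit n, (genericCnotCount T : ℝ) ≤ 8 * (2 : ℝ) ^ n ∧
      UniversalUpToMeasurement E T := by
  obtain ⟨ψ, hψ, hsim⟩ := hE.exists_unit_vector
  obtain ⟨T, hT, h⟩ := exists_genericCircuit_disentangle n le_rfl
  have h' : ∀ v : Amplitudes n, ∃ c : Circuit n, List.Forall₂ GenericGate.Specializes T c ∧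
      ∃ z : ℂ, circuitMatrix c *ᵥ v = z • Pi.single 0 1 := by
    intro v
    obtain ⟨c, hc, hd⟩ := h v fun x j hj => absurd j.2 (not_lt.2 hj)
    exact ⟨c, hc, _, hd.eq_smul⟩
  obtain ⟨d, hd, y, hy⟩ := h' ψ
  have hψ' := mulVec_eq_smul_imp hy
  have hy0 : y ≠ 0 := by
    rintro rfl
    exact hψ.ne_zero (by rw [hψ', zero_smul])
  -- Only the first half varies with `u`. The way from `|0…0⟩` to `ψ` is frozen into singleton
  -- placeholders, and each half costs at most `4 * 2 ^ n` CNOTs.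
  refine ⟨T ++ (inverseCircuit d).map Gate.toGeneric, ?_, fun u => ?_⟩
  · have : genericCnotCount (T ++ (inverseCircuit d).map Gate.toGeneric) ≤ 8 * 2 ^ n := by
      rw [genericCnotCount_append,
        genericCnotCount_of_specializes (forall₂_specializes_toGeneric _),
        cnotCount_inverseCircuit, ← genericCnotCount_of_specializes hd]
      omega
    exact_mod_cast this
  · obtain ⟨c, hc, z, hz⟩ := h' ((u.1)ᴴ *ᵥ ψ)
    refine ⟨c ++ inverseCircuit d, forall₂_append hc (forall₂_specializes_toGeneric _),
      (hsim _ _).2 ⟨z * y⁻¹, ?_⟩⟩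
    rw [circuitMatrix_append, ← mulVec_mulVec, hz, circuitMatrix_inverseCircuit, mulVec_smul,
      mul_smul]
    congr 1
    rw [eq_inv_smul_iff₀ hy0]
    exact hψ'.symm

/-! ### Two qubits: Schmidt decomposition and the determinant invariant -/

open scoped ComplexOrder in
/-- The singular value decomposition of a complex square matrix. -/
theorem exists_singular_value_decomposition {ι : Type*} [Fintype ι] [DecidableEq ι]
    (M : Matrix ι ι ℂ) : ∃ (A B : unitaryGroup ι ℂ) (d : ι → ℝ), (∀ i, 0 ≤ d i) ∧
      M = A.1 * diagonal (fun i => (d i : ℂ)) * B.1 := by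
  have hp : (Mᴴ * M).PosSemidef := posSemidef_conjTranspose_mul_self M
  set V := hp.1.eigenvectorUnitary
  set N := M * V.1 with hN
  set d : ι → ℝ := fun i => √(hp.1.eigenvalues i) with hd
  -- In an eigenbasis of `Mᴴ * M` the columns of `N` are orthogonal with lengths `d i`. Normalizing
  -- the nonzero ones and completing them to a basis gives the left factor.
  have hNN : Nᴴ * N = diagonal (fun i => (hp.1.eigenvalues i : ℂ)) := by
    have := hp.1.conjStarAlgAut_star_eigenvectorUnitary
    rw [Unitary.conjStarAlgAut_star_apply] at this
    rw [hN, conjTranspose_mul, Matrix.mul_assoc, ← Matrix.mul_assoc Mᴴ, ← Matrix.mul_assoc]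
    exact this
  let col : ι → EuclideanSpace ℂ ι := fun i => WithLp.toLp 2 fun x => N x i
  have hinner : ∀ i j, inner ℂ (col i) (col j) = if i = j then (d i : ℂ) ^ 2 else 0 := by
    intro i j
    have h := congrFun (congrFun hNN i) j
    rw [diagonal_apply, Matrix.mul_apply] at h
    have h2 : inner ℂ (col i) (col j) = ∑ x, Nᴴ i x * N x j := by
      simp [col, PiLp.inner_apply, mul_comm]
    rw [h2, h]
    split_ifs with hij
    · rw [hd]
      simp only
      rw [← Complex.ofReal_pow, Real.sq_sqrt (hp.eigenvalues_nonneg i)]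
    · rfl
  have ho : Orthonormal ℂ (Set.domRestrict {i | d i ≠ 0} fun i => ((d i)⁻¹ : ℂ) • col i) := by
    rw [orthonormal_iff_ite]
    rintro ⟨i, hi⟩ ⟨j, hj⟩
    simp only [Set.domRestrict_apply, inner_smul_left, inner_smul_right, hinner, Subtype.mk.injEq]
    by_cases hij : i = j
    · subst hij
      have : (d i : ℂ) ≠ 0 := by exact_mod_cast hi
      simp only [if_true, map_inv₀, Complex.conj_ofReal]
      field_simp
    · simp [hij]
  obtain ⟨b, hb⟩ := ho.exists_orthonormalBasis_extension_of_card_eq (by simp)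
  let A : unitaryGroup ι ℂ := ⟨(EuclideanSpace.basisFun ι ℂ).toBasis.toMatrix b,
    OrthonormalBasis.toMatrix_orthonormalBasis_mem_unitary _ _⟩
  have hA : ∀ x i, A.1 x i = b i x := fun x i => by simp [A, Module.Basis.toMatrix_apply]
  have hAN : A.1 * diagonal (fun i => (d i : ℂ)) = N := by
    ext x i
    rw [mul_diagonal, hA]
    -- For `d i = 0` the column of `N` vanishes, so the basis vector chosen there is irrelevant.
    by_cases hi : d i = 0
    · have h0 := hinner i i
      rw [if_pos rfl, hi, Complex.ofReal_zero, sq, zero_mul, inner_self_eq_zero] at h0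
      have := congrArg (fun w : EuclideanSpace ℂ ι => w x) h0
      simp only [col, PiLp.zero_apply] at this
      rw [hi, this, Complex.ofReal_zero, mul_zero]
    · have : (d i : ℂ) ≠ 0 := by exact_mod_cast hi
      rw [hb i hi]
      simp only [col, PiLp.smul_apply, smul_eq_mul]
      field_simp
  refine ⟨A, V⁻¹, d, fun i => Real.sqrt_nonneg _, ?_⟩
  rw [hAN, hN, Matrix.mul_assoc, ← UnitaryGroup.mul_val, mul_inv_cancel, UnitaryGroup.one_val,
    Matrix.mul_one]

/-- The amplitudes of a two-qubit state as a matrix. -/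
def amplitudeMatrix (v : Amplitudes 2) : Matrix (Fin 2) (Fin 2) ℂ :=
  of fun i j => v ![i, j]

theorem amplitudeMatrix_injective : Injective amplitudeMatrix := by
  intro v w h
  funext x
  have h1 : x = ![x 0, x 1] := by
    funext i
    fin_cases i <;> rfl
  rw [h1]
  exact congrFun (congrFun h (x 0)) (x 1)

theorem amplitudeMatrix_applyQubit_zero (a : Matrix (Fin 2) (Fin 2) ℂ) (v : Amplitudes 2) :
    amplitudeMatrix (applyQubit 0 a v) = a * amplitudeMatrix v := by
  ext i j
  have h : ∀ b, update ![i, j] 0 b = ![b, j] := fun b => by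
    funext k; fin_cases k <;> rfl
  simp [amplitudeMatrix, applyQubit, Matrix.mul_apply, h]

theorem amplitudeMatrix_applyQubit_one (a : Matrix (Fin 2) (Fin 2) ℂ) (v : Amplitudes 2) :
    amplitudeMatrix (applyQubit 1 a v) = amplitudeMatrix v * aᵀ := by
  ext i j
  have h : ∀ b, update ![i, j] 1 b = ![i, b] := fun b => by
    funext k; fin_cases k <;> rfl
  simp [amplitudeMatrix, applyQubit, Matrix.mul_apply, h, mul_comm]

theorem amplitudeMatrix_applyCnot (v : Amplitudes 2) :
    amplitudeMatrix (applyCnot 0 1 v) = !![amplitudeMatrix v 0 0, amplitudeMatrix v 0 1;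
      amplitudeMatrix v 1 1, amplitudeMatrix v 1 0] := by
  have h : ∀ i j b : Fin 2, update ![i, j] 1 b = ![i, b] := fun i j b => by
    funext k; fin_cases k <;> rfl
  ext i j
  fin_cases i <;> fin_cases j <;> simp [amplitudeMatrix, applyCnot, h]

theorem isUnitVector_iff_trace (v : Amplitudes 2) :
    IsUnitVector v ↔ ((amplitudeMatrix v)ᴴ * amplitudeMatrix v).trace = 1 := by
  rw [IsUnitVector, dotProduct, ← (finTwoArrowEquiv (Fin 2)).symm.sum_comp,
    Fintype.sum_prod_type_right]
  simp [trace, Matrix.mul_apply, amplitudeMatrix, finTwoArrowEquiv]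

theorem norm_det_unitary (a : OneQubit) : ‖a.1.det‖ = 1 := by
  have h := congrArg norm (Unitary.mem_iff.1 (det_of_mem_unitary a.2)).1
  rw [norm_mul, norm_star, norm_one] at h
  nlinarith [norm_nonneg a.1.det]

/-- A gate on qubit `0` multiplies the amplitude matrix on the left, one on qubit `1` multiplies it
by the transpose on the right; both have determinants of modulus `1`. -/
theorem norm_det_amplitudeMatrix_applyQubit (q : Fin 2) (a : OneQubit) (v : Amplitudes 2) :
    ‖(amplitudeMatrix (applyQubit q a.1 v)).det‖ = ‖(amplitudeMatrix v).det‖ := by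
  fin_cases q
  · simp [amplitudeMatrix_applyQubit_zero, norm_det_unitary]
  · simp [amplitudeMatrix_applyQubit_one, norm_det_unitary]

theorem norm_det_amplitudeMatrix_circuit {c : Circuit 2} (hc : cnotCount c = 0)
    (v : Amplitudes 2) :
    ‖(amplitudeMatrix (circuitMatrix c *ᵥ v)).det‖ = ‖(amplitudeMatrix v).det‖ := by
  induction c generalizing v with
  | nil => simp [circuitMatrix]
  | cons g c ih =>
    cases g with
    | oneQubit q a =>
      rw [circuitMatrix, ← mulVec_mulVec, ih hc, Gate.matrix, oneQubitMatrix_mulVec,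
        norm_det_amplitudeMatrix_applyQubit]
    | cnot r t h => simp [cnotCount] at hc

theorem amplitudeMatrix_smul (z : ℂ) (v : Amplitudes 2) :
    amplitudeMatrix (z • v) = z • amplitudeMatrix v := rfl

/-- The two-qubit state `x |00⟩ + y |11⟩`. -/
def schmidtState (x y : ℂ) : Amplitudes 2 :=
  fun b => !![x, 0; 0, y] (b 0) (b 1)

theorem amplitudeMatrix_schmidtState (x y : ℂ) :
    amplitudeMatrix (schmidtState x y) = !![x, 0; 0, y] := by
  ext i j
  simp [amplitudeMatrix, schmidtState]

theorem isUnitVector_schmidtState {x y : ℝ} (h : x ^ 2 + y ^ 2 = 1) :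
    IsUnitVector (schmidtState x y) := by
  rw [isUnitVector_iff_trace, amplitudeMatrix_schmidtState]
  have : (x : ℂ) * x + y * y = 1 := by
    rw [sq, sq] at h
    exact_mod_cast h
  simpa [trace, Matrix.mul_apply] using this

theorem exists_operator_one_le_cnotCount (E : Fin 2 → Submodule ℂ (StateSpace 2))
    (hE : IsLineMeasurement E) :
    ∃ u : Operator 2, ∀ c : Circuit 2, SimulatesUpToMeasurement E c u → 1 ≤ cnotCount c := by
  obtain ⟨ψ, hψ, hsim⟩ := hE.exists_unit_vector
  obtain ⟨φ, hφ, hdet⟩ : ∃ φ : Amplitudes 2, IsUnitVector φ ∧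
      ‖(amplitudeMatrix φ).det‖ ≠ ‖(amplitudeMatrix ψ).det‖ := by
    -- If `ψ` is a product state, an entangled state with determinant `12 / 25` differs from it;
    -- otherwise the product state `|00⟩` does.
    by_cases h : ‖(amplitudeMatrix ψ).det‖ = 0
    · refine ⟨schmidtState (3 / 5 : ℝ) (4 / 5 : ℝ), isUnitVector_schmidtState (by norm_num), ?_⟩
      rw [h, amplitudeMatrix_schmidtState, det_fin_two_of]
      norm_num
    · refine ⟨schmidtState (1 : ℝ) (0 : ℝ), isUnitVector_schmidtState (by norm_num), ?_⟩
      rw [amplitudeMatrix_schmidtState, det_fin_two_of]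
      simpa using Ne.symm h
  obtain ⟨u, hu⟩ := hψ.exists_operator hφ
  refine ⟨u, fun c hc => Nat.one_le_iff_ne_zero.2 fun h0 => hdet ?_⟩
  obtain ⟨z, hz⟩ := (hsim c u).1 hc
  rw [hu] at hz
  have hz1 : ‖z‖ = 1 := hψ.norm_eq_one_of_smul
    (hz ▸ hφ.unitary_mulVec (mem_unitaryGroup_iff'.1 (circuitMatrix_mem c)))
  rw [← norm_det_amplitudeMatrix_circuit h0 φ, hz, amplitudeMatrix_smul, det_smul]
  simp [hz1]

/-- A two-qubit state is determined up to local unitaries by the modulus of its determinant. -/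
theorem IsUnitVector.exists_schmidt_decomposition {v : Amplitudes 2} (hv : IsUnitVector v) :
    ‖(amplitudeMatrix v).det‖ ≤ 1 / 2 ∧ ∃ A B : OneQubit, ∃ x y : ℝ,
      x + y = √(1 + 2 * ‖(amplitudeMatrix v).det‖) ∧
      x - y = √(1 - 2 * ‖(amplitudeMatrix v).det‖) ∧ x ^ 2 + y ^ 2 = 1 ∧
      v = applyQubit 0 A.1 (applyQubit 1 B.1 (schmidtState x y)) := by
  have key : ∃ A B : OneQubit, ∃ x y : ℝ, 0 ≤ y ∧ y ≤ x ∧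
      amplitudeMatrix v = A.1 * !![(x : ℂ), 0; 0, (y : ℂ)] * B.1 := by
    obtain ⟨A, B, d, hd, hM⟩ := exists_singular_value_decomposition (amplitudeMatrix v)
    have hdiag : diagonal (fun i => (d i : ℂ)) = !![(d 0 : ℂ), 0; 0, (d 1 : ℂ)] := by
      ext i j
      fin_cases i <;> fin_cases j <;> simp
    rw [hdiag] at hM
    -- Ordering the singular values makes `x - y` nonnegative. From `x ^ 2 + y ^ 2 = 1` and `x * y =
    -- ‖det‖`, both `x + y` and `x - y` are then determined as square roots.
    rcases le_total (d 1) (d 0) with h | h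
    · exact ⟨A, B, d 0, d 1, hd 1, h, hM⟩
    · have hX : (!![0, 1; 1, 0] : Matrix (Fin 2) (Fin 2) ℂ) ∈ unitaryGroup (Fin 2) ℂ := by
        rw [mem_unitaryGroup_iff]
        ext i j
        fin_cases i <;> fin_cases j <;> simp [Matrix.mul_apply, star_eq_conjTranspose]
      refine ⟨A * ⟨_, hX⟩, ⟨_, hX⟩ * B, d 1, d 0, hd 0, h, ?_⟩
      have hswap : (!![0, 1; 1, 0] : Matrix (Fin 2) (Fin 2) ℂ) * !![(d 1 : ℂ), 0; 0, (d 0 : ℂ)] *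
          !![0, 1; 1, 0] = !![(d 0 : ℂ), 0; 0, (d 1 : ℂ)] := by
        ext i j
        fin_cases i <;> fin_cases j <;> simp [Matrix.mul_apply]
      rw [hM, ← hswap]
      simp only [UnitaryGroup.mul_val, Matrix.mul_assoc]
  obtain ⟨A, B, x, y, hy, hxy, hM⟩ := key
  have hx : 0 ≤ x := hy.trans hxy
  have hdet : ‖(amplitudeMatrix v).det‖ = x * y := by
    rw [hM, det_mul, det_mul, norm_mul, norm_mul, norm_det_unitary, norm_det_unitary,
      det_fin_two_of]
    simp [abs_of_nonneg hx, abs_of_nonneg hy]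
  have hsq : x ^ 2 + y ^ 2 = 1 := by
    rw [isUnitVector_iff_trace, hM] at hv
    have hA : (A.1)ᴴ * A.1 = 1 := mem_unitaryGroup_iff'.1 A.2
    have hB : B.1 * (B.1)ᴴ = 1 := mem_unitaryGroup_iff.1 B.2
    rw [conjTranspose_mul, conjTranspose_mul, Matrix.mul_assoc, trace_mul_comm,
      Matrix.mul_assoc, Matrix.mul_assoc _ _ ((B.1)ᴴ), hB, Matrix.mul_one,
      Matrix.mul_assoc, ← Matrix.mul_assoc _ A.1, hA, Matrix.one_mul] at hv
    have hv' : (x : ℂ) * x + y * y = 1 := by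
      simpa [trace, Matrix.mul_apply] using hv
    rw [sq, sq]
    exact_mod_cast hv'
  rw [hdet]
  refine ⟨by nlinarith [sq_nonneg (x - y)], A, UnitaryGroup.transpose B, x, y, ?_, ?_, hsq, ?_⟩
  · rw [eq_comm, Real.sqrt_eq_iff_mul_self_eq (by positivity) (by positivity)]
    linarith
  · rw [eq_comm, Real.sqrt_eq_iff_mul_self_eq (by nlinarith [sq_nonneg (x - y)]) (by linarith)]
    linarith
  · apply amplitudeMatrix_injective
    rw [amplitudeMatrix_applyQubit_zero, amplitudeMatrix_applyQubit_one,
      amplitudeMatrix_schmidtState, hM, UnitaryGroup.transpose_coe, transpose_transpose,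
      Matrix.mul_assoc]

theorem applyQubit_inv_applyQubit {n : ℕ} (q : Fin n) (a : OneQubit) (v : Amplitudes n) :
    applyQubit q (a⁻¹).1 (applyQubit q a.1 v) = v := by
  rw [applyQubit_mul, ← UnitaryGroup.mul_val, inv_mul_cancel, UnitaryGroup.one_val, applyQubit_one]

/-- Equal determinants in modulus give the same Schmidt coefficients, so both vectors are local
images of one Schmidt state. -/
theorem exists_locally_equivalent {v w : Amplitudes 2} (hv : IsUnitVector v)
    (hw : IsUnitVector w) (h : ‖(amplitudeMatrix v).det‖ = ‖(amplitudeMatrix w).det‖) :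
    ∃ A B : OneQubit, applyQubit 1 B.1 (applyQubit 0 A.1 v) = w := by
  obtain ⟨-, A, B, x, y, h1, h2, -, hv'⟩ := hv.exists_schmidt_decomposition
  obtain ⟨-, A', B', x', y', h1', h2', -, hw'⟩ := hw.exists_schmidt_decomposition
  rw [h] at h1 h2
  have hx : x = x' := by linarith
  have hy : y = y' := by linarith
  subst hx hy
  refine ⟨A' * A⁻¹, B' * B⁻¹, ?_⟩
  simp only [UnitaryGroup.mul_val, ← applyQubit_mul]
  rw [hv', applyQubit_inv_applyQubit, applyQubit_comm (q := 0) (r := 1) (by decide),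
    applyQubit_inv_applyQubit, applyQubit_comm (q := 1) (r := 0) (by decide), hw']

/-- One CNOT reaches every admissible modulus of the determinant. -/
theorem exists_norm_det_applyCnot {v : Amplitudes 2} (hv : IsUnitVector v) {p : ℝ} (hp0 : 0 ≤ p)
    (hp : p ≤ 1 / 2) : ∃ A B : OneQubit,
      ‖(amplitudeMatrix (applyCnot 0 1 (applyQubit 1 B.1 (applyQubit 0 A.1 v)))).det‖ = p := by
  obtain ⟨-, A, B, x, y, -, -, hxy, hv'⟩ := hv.exists_schmidt_decomposition
  -- After undoing the Schmidt factors, rotating qubit `0` by `t` and applying the CNOT, the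
  -- determinant is `(x ^ 2 + y ^ 2) * sin t * cos t = sin (2 * t) / 2`.
  set t := Real.arcsin (2 * p) / 2 with ht
  have hst : Real.sin t * Real.cos t = p := by
    have h2 := Real.sin_two_mul t
    rw [ht, mul_div_cancel₀ _ two_ne_zero, Real.sin_arcsin (by linarith) (by linarith),
      ← ht] at h2
    linarith
  refine ⟨rotationY t * A⁻¹, B⁻¹, ?_⟩
  simp only [UnitaryGroup.mul_val, ← applyQubit_mul]
  rw [hv', applyQubit_inv_applyQubit, applyQubit_comm (q := 1) (r := 0) (by decide),
    applyQubit_inv_applyQubit, amplitudeMatrix_applyCnot, amplitudeMatrix_applyQubit_zero,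
    amplitudeMatrix_schmidtState, det_fin_two_of]
  have hval : (x : ℂ) * Real.cos t * (x * Real.sin t) - (-(y * Real.sin t)) * (y * Real.cos t) =
      (p : ℂ) := by
    rw [← hst, ← mul_one (Real.sin t * Real.cos t), ← hxy]
    push_cast
    ring
  rw [← Real.norm_of_nonneg hp0, ← Complex.norm_real, ← hval]
  congr 1
  simp [rotationY, Matrix.mul_apply]
  ring

theorem exists_genericCircuit_one_cnot (E : Fin 2 → Submodule ℂ (StateSpace 2))
    (hE : IsLineMeasurement E) :
    ∃ T : GenericCircuit 2, genericCnotCount T = 1 ∧ UniversalUpToMeasurement E T := by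
  obtain ⟨ψ, hψ, hsim⟩ := hE.exists_unit_vector
  refine ⟨[.placeholder 0 Set.univ, .placeholder 1 Set.univ, .cnot 0 1 (by decide),
    .placeholder 0 Set.univ, .placeholder 1 Set.univ], rfl, fun u => ?_⟩
  have hφ := hψ.conjTranspose_mulVec u
  obtain ⟨A, B, hdet⟩ := exists_norm_det_applyCnot hφ (norm_nonneg (amplitudeMatrix ψ).det)
    hψ.exists_schmidt_decomposition.1
  have hlocal (c : Circuit 2) (v : Amplitudes 2) (hv : IsUnitVector v) :
      IsUnitVector (circuitMatrix c *ᵥ v) :=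
    hv.unitary_mulVec (mem_unitaryGroup_iff'.1 (circuitMatrix_mem c))
  have hunit := hlocal [.oneQubit 0 A, .oneQubit 1 B, .cnot 0 1 (by decide)] _ hφ
  simp only [circuitMatrix, Gate.matrix, ← mulVec_mulVec, one_mulVec, oneQubitMatrix_mulVec,
    cnotMatrix_mulVec (show (0 : Fin 2) ≠ 1 by decide)] at hunit
  obtain ⟨A', B', h⟩ := exists_locally_equivalent hunit hψ hdet
  refine ⟨[.oneQubit 0 A, .oneQubit 1 B, .cnot 0 1 (by decide), .oneQubit 0 A', .oneQubit 1 B'],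
    ?_, (hsim _ _).2 ⟨1, ?_⟩⟩
  · have hp (q : Fin 2) (a : OneQubit) :
        GenericGate.Specializes (.placeholder q Set.univ) (.oneQubit q a) :=
      .placeholder _ _ _ (Set.mem_univ _)
    exact .cons (hp _ _) (.cons (hp _ _) (.cons (.cnot _ _ _) (.cons (hp _ _)
      (.cons (hp _ _) .nil))))
  · simp only [circuitMatrix, Gate.matrix, ← mulVec_mulVec, one_mulVec, oneQubitMatrix_mulVec,
      cnotMatrix_mulVec (show (0 : Fin 2) ≠ 1 by decide), one_smul]
    exact h

end QuantumCircuit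

theorem mainTheorem5 :
    (∀ (n : ℕ) (E : Fin 2 → Submodule ℂ (QuantumCircuit.StateSpace n)),
      QuantumCircuit.IsLineMeasurement E →
      ∃ u : QuantumCircuit.Operator n, ∀ c : QuantumCircuit.Circuit n,
        QuantumCircuit.SimulatesUpToMeasurement E c u →
        ⌈((2 : ℝ) ^ n - 3 * (n : ℝ) - 1) / 4⌉ ≤ (QuantumCircuit.cnotCount c : ℤ)) ∧
    (∃ C : ℝ, ∀ (n : ℕ) (E : Fin 2 → Submodule ℂ (QuantumCircuit.StateSpace n)),
      QuantumCircuit.IsLineMeasurement E →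
      ∃ T : QuantumCircuit.GenericCircuit n,
        (QuantumCircuit.genericCnotCount T : ℝ) ≤ C * (2 : ℝ) ^ n ∧
        QuantumCircuit.UniversalUpToMeasurement E T) ∧
    (∀ E : Fin 2 → Submodule ℂ (QuantumCircuit.StateSpace 2),
      QuantumCircuit.IsLineMeasurement E →
      (∃ u : QuantumCircuit.Operator 2, ∀ c : QuantumCircuit.Circuit 2,
        QuantumCircuit.SimulatesUpToMeasurement E c u → 1 ≤ QuantumCircuit.cnotCount c) ∧
      (∃ T : QuantumCircuit.GenericCircuit 2,
        QuantumCircuit.genericCnotCount T = 1 ∧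
        QuantumCircuit.UniversalUpToMeasurement E T)) :=
  ⟨fun _ E hE => QuantumCircuit.exists_operator_cnotCount_lower_bound E hE,
    ⟨8, fun _ E hE => QuantumCircuit.exists_genericCircuit_universal E hE⟩,
    fun E hE => ⟨QuantumCircuit.exists_operator_one_le_cnotCount E hE,
      QuantumCircuit.exists_genericCircuit_one_cnot E hE⟩⟩
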